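/- Consider a system of $K$ primary links and fix one link $k$, whose receiver has $N$ antennas. For $j=1,\dots,K$ let $\alpha_{k,j}>0$ be the path loss and $\mathbf H_{k,j}\in\mathbb C^{N\times M_j}$ the (random) channel matrix from the $j$-th transmitter to the $k$-th receiver, and let $\mathbf t_j\in\mathbb C^{M_j}$ be the (random) transmit beamforming vector of link $j$, with $\|\mathbf t_j\|_2^2=P_j>0$ almost surely. Let $\hat{\mathbf H}=[\hat{\mathbf h}_1,\dots,\hat{\mathbf h}_K]$ be the $N\times K$ matrix with columns $\hat{\mathbf h}_j=\sqrt{\alpha_{k,j}}\,\mathbf H_{k,j}\mathbf t_j$, and let $\hat{\mathbf H}_{(-k)}$ be $\hat{\mathbf H}$ with its $k$-th column deleted. Write $\mathcal{CN}(0,v)$ for the circularly symmetric complex Gaussian law (independent real and imaginary parts, each centred with variance $v/2$). A *normalized complex Gaussian vector* in $\mathbb C^N$ is $\mathbf z/\|\mathbf z\|_2$ with $\mathbf z\sim\mathcal{CN}(\mathbf 0,\mathbf I)$. A random Hermitian matrix $\mathbf W$ is *unitarily invariant* if $\mathbf W$ and $\mathbf G\mathbf W\mathbf G^H$ have the same joint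 distribution of entries for every unitary matrix $\mathbf G$ (possibly random) independent of $\mathbf W$. Assume that 1. the columns $\hat{\mathbf h}_1,\dots,\hat{\mathbf h}_K$ are independent; 2. $\hat{\mathbf h}_k$ has the same distribution as $s\,\mathbf x$, where $\mathbf x$ is a normalized complex Gaussian vector and $s$ is a (possibly random) almost surely positive scaling factor; 3. the entries of $\hat{\mathbf H}_{(-k)}$ are independent, those in the column $\hat{\mathbf h}_j$ ($j\ne k$) having law $\mathcal{CN}(0,\alpha_{k,j}P_j)$. Let $N_0>0$, and for each of the three receivers let $$\mathbf W_k^{\mathrm{MF}}=\mathbf I,\qquad \mathbf W_k^{\mathrm{ZF}}=\mathbf I-\hat{\mathbf H}_{(-k)}\bigl(\hat{\mathbf H}_{(-k)}^H\hat{\mathbf H}_{(-k)}\bigr)^{-1}\hat{\mathbf H}_{(-k)}^H,\qquad \mathbf W_k^{\mathrm{MMSE}}=\bigl(\hat{\mathbf H}_{(-k)}\hat{\mathbf H}_{(-k)}^H+N_0\mathbf I\bigr)^{-1},$$ and $\mathbf r_k=\mathbf W_k\hat{\mathbf h}_k/\|\mathbf W_k\hat{\mathbf h}_k\|_2$. Then: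 * for the matched-filter (MF) and the minimum-mean-squared-error (MMSE) receivers, $\mathbf W_k$ is unitarily invariant and $\mathbf r_k$ has the same distribution as a normalized complex Gaussian vector in $\mathbb C^N$; * for the zero-forcing (ZF) receiver, if $K-1\le N$, then $\hat{\mathbf H}_{(-k)}^H\hat{\mathbf H}_{(-k)}$ is almost surely invertible and $\mathbf W_k$ is unitarily invariant; if moreover $K-1<N$, then $\mathbf r_k$ has the same distribution as a normalized complex Gaussian vector in $\mathbb C^N$. -/

import Mathlib

open MeasureTheory ProbabilityTheory
open scoped Matrix NNReal

noncomputable section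

/-- The product sigma-algebra on matrices: a random matrix is a random family of entries. -/
instance matrixMeasurableSpace {m n : Type*} : MeasurableSpace (Matrix m n ℂ) :=
  inferInstanceAs (MeasurableSpace (m → n → ℂ))

/-- The circularly symmetric complex Gaussian law `CN(0, v)`: independent real and imaginary parts,
each a centred real Gaussian of variance `v / 2`. -/
def complexGaussian (v : ℝ≥0) : Measure ℂ :=
  ((gaussianReal 0 (v / 2)).prod (gaussianReal 0 (v / 2))).map
    (fun p : ℝ × ℝ => (⟨p.1, p.2⟩ : ℂ))

/-- The law `CN(0, I)` of a standard complex Gaussian vector in `ℂⁿ`. -/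
def stdComplexGaussianVec (n : ℕ) : Measure (EuclideanSpace ℂ (Fin n)) :=
  (Measure.pi (fun _ : Fin n => complexGaussian 1)).map (WithLp.toLp 2)

/-- The vector `z / ‖z‖₂` (with value `0` at `z = 0`). -/
def unitVec {n : ℕ} (z : EuclideanSpace ℂ (Fin n)) : EuclideanSpace ℂ (Fin n) :=
  ((1 / ‖z‖ : ℝ) : ℂ) • z

/-- The law of a normalized complex Gaussian vector, that is, of `z / ‖z‖₂` with
`z ∼ CN(0, I)`. -/
def normalizedComplexGaussian (n : ℕ) : Measure (EuclideanSpace ℂ (Fin n)) :=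
  (stdComplexGaussianVec n).map unitVec

/-- A random Hermitian matrix `W` is unitarily invariant if `W` and `G W Gᴴ` have the same joint
distribution of entries for every (possibly random) unitary matrix `G` independent of `W`. -/
def IsUnitarilyInvariant {Ω : Type*} [MeasurableSpace Ω] (μ : Measure Ω) {n : ℕ}
    (W : Ω → Matrix (Fin n) (Fin n) ℂ) : Prop :=
  (∀ᵐ ω ∂μ, (W ω).IsHermitian) ∧
  ∀ G : Ω → Matrix (Fin n) (Fin n) ℂ, Measurable G →
    (∀ ω, G ω ∈ Matrix.unitaryGroup (Fin n) ℂ) → IndepFun G W μ →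
      IdentDistrib W (fun ω => G ω * W ω * (G ω)ᴴ) μ μ

/-- The matrix `Ĥ = [√a₁ H₁ t₁, …, √a_K H_K t_K]` seen by one fixed receiver with `N` antennas:
`a j` is the path loss and `H j` the channel matrix from transmitter `j` (with `M j` antennas) to
this receiver, and `t j` is the beamforming vector of transmitter `j`. -/
def effectiveChannel {K N : ℕ} {M : Fin K → ℕ} (a : Fin K → ℝ)
    (H : (j : Fin K) → Matrix (Fin N) (Fin (M j)) ℂ)
    (t : (j : Fin K) → EuclideanSpace ℂ (Fin (M j))) : Matrix (Fin N) (Fin K) ℂ :=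
  fun i j => (√(a j) : ℂ) * (H j *ᵥ (t j).ofLp) i

/-- The `j`-th column of a matrix, as a vector with the Euclidean norm. -/
def column {N K : ℕ} (A : Matrix (Fin N) (Fin K) ℂ) (j : Fin K) : EuclideanSpace ℂ (Fin N) :=
  WithLp.toLp 2 (fun i => A i j)

/-- The matrix with the `k`-th column deleted. -/
def deleteColumn {N K : ℕ} (A : Matrix (Fin N) (Fin K) ℂ) (k : Fin K) :
    Matrix (Fin N) {j : Fin K // j ≠ k} ℂ :=
  fun i j => A i j.1

/-- Matched filter: `W = I`. -/
def weightMF (N : ℕ) : Matrix (Fin N) (Fin N) ℂ := 1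

/-- Zero forcing: `W = I - B (Bᴴ B)⁻¹ Bᴴ`, where `B` is `A` with column `k` deleted. -/
def weightZF {N K : ℕ} (A : Matrix (Fin N) (Fin K) ℂ) (k : Fin K) : Matrix (Fin N) (Fin N) ℂ :=
  1 - deleteColumn A k * ((deleteColumn A k)ᴴ * deleteColumn A k)⁻¹ * (deleteColumn A k)ᴴ

/-- MMSE: `W = (B Bᴴ + N₀ I)⁻¹`, where `B` is `A` with column `k` deleted. -/
def weightMMSE {N K : ℕ} (N₀ : ℝ) (A : Matrix (Fin N) (Fin K) ℂ) (k : Fin K) :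
    Matrix (Fin N) (Fin N) ℂ :=
  (deleteColumn A k * (deleteColumn A k)ᴴ + (N₀ : ℂ) • (1 : Matrix (Fin N) (Fin N) ℂ))⁻¹

/-- The receive beamforming vector `W h / ‖W h‖₂`. -/
def receiveBeamformer {N : ℕ} (W : Matrix (Fin N) (Fin N) ℂ) (h : EuclideanSpace ℂ (Fin N)) :
    EuclideanSpace ℂ (Fin N) :=
  unitVec (WithLp.toLp 2 (W *ᵥ h.ofLp))

end

/-! Each filter is a function `f` of the interference matrix `B`, that is `Ĥ` without column `k`,
and satisfies `f (U * B) = U * f B * Uᴴ` for unitary `U`. The Gaussian law of `B` is invariant under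
`B ↦ U * B`, because the variance is constant along each column. Hence `f B` and `U * f B * Uᴴ` have
the same law, and a random `G` independent of the filter is handled by Fubini
(`isUnitarilyInvariant_of_equivariant`).

For the beamformer, normalization discards the length of column `k`, so that column may be replaced
by a standard Gaussian `z` independent of `B`. Passing from `(B, z)` to `(U * B, U *ᵥ z)` keeps the
joint law and rotates `f B *ᵥ z` by `U`; its direction therefore has a unitarily invariant law on
the unit sphere. Such a law is unique (`eq_of_unitary_invariant_of_norm_eq_one`).

Almost sure nonvanishing of `f B *ᵥ z` and invertibility of the Gram matrix both come from
`ae_eval_ne_zero`: the zero set of a nonzero polynomial is null. -/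

/-! ### Null sets of polynomials -/

theorem measurableSet_eval_ne_zero {ι : Type*} [Finite ι] (p : MvPolynomial ι ℂ) :
    MeasurableSet {x : ι → ℂ | MvPolynomial.eval x p ≠ 0} :=
  (isOpen_ne.preimage (MvPolynomial.continuous_eval p)).measurableSet

/-- A nonzero polynomial is almost everywhere nonzero for a product of atomless measures. -/
theorem ae_eval_ne_zero_fin {n : ℕ} (ν : Fin n → Measure ℂ) [∀ i, SigmaFinite (ν i)]
    [∀ i, NullSingletonClass (ν i)] {p : MvPolynomial (Fin n) ℂ} (hp : p ≠ 0) :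
    ∀ᵐ x ∂Measure.pi ν, MvPolynomial.eval x p ≠ 0 := by
  induction n with
  | zero =>
    refine Filter.Eventually.of_forall fun x hx => hp ?_
    rw [MvPolynomial.eq_C_of_isEmpty p] at hx ⊢
    simpa using hx
  | succ n ih =>
    have hp' : MvPolynomial.finSuccEquiv ℂ n p ≠ 0 := by
      simpa using hp
    -- A nonzero coefficient in the first variable is a polynomial in the others, to which induction
    -- applies. Where it does not vanish, the remaining one-variable polynomial has finitely many
    -- roots, a null set.
    obtain ⟨d, hd⟩ : ∃ d, (MvPolynomial.finSuccEquiv ℂ n p).coeff d ≠ 0 := by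
      by_contra! h
      exact hp' (Polynomial.ext (by simpa using h))
    have hm := (measurePreserving_piFinSuccAbove ν 0).symm
    rw [← hm.map_eq, ae_map_iff hm.measurable.aemeasurable
      (measurableSet_eval_ne_zero p)]
    have hms : MeasurableSet {z : ℂ × (Fin n → ℂ) | MvPolynomial.eval
        ((MeasurableEquiv.piFinSuccAbove (fun _ : Fin (n + 1) => ℂ) 0).symm z) p ≠ 0} :=
      (MeasurableEquiv.measurable _)
        (measurableSet_eval_ne_zero p)
    rw [Measure.ae_prod_iff_ae_ae hms, Measure.ae_ae_comm hms]
    filter_upwards [ih (fun j => ν (Fin.succAbove 0 j)) hd] with y hy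
    set q := Polynomial.map (MvPolynomial.eval y) (MvPolynomial.finSuccEquiv ℂ n p) with hq
    have hq0 : q ≠ 0 := by
      intro h
      apply hy
      rw [← Polynomial.coeff_map, ← hq, h, Polynomial.coeff_zero]
    have hfin : Set.Finite {z | q.IsRoot z} := Polynomial.finite_setOfPred_isRoot hq0
    have := hfin.measure_zero (ν 0)
    refine (measure_eq_zero_iff_ae_notMem.mp this).mono fun z hz h => hz ?_
    have h2 := MvPolynomial.eval_eq_eval_mv_eval' y z p
    have h3 : (MeasurableEquiv.piFinSuccAbove (fun _ : Fin (n + 1) => ℂ) 0).symm (z, y)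
        = Fin.cons z y := by
      ext i
      simp [MeasurableEquiv.piFinSuccAbove, Fin.insertNthEquiv]
    rw [h3, h2] at h
    exact h

/-- A nonzero polynomial is almost everywhere nonzero for a product of atomless measures. -/
theorem ae_eval_ne_zero {ι : Type*} [Fintype ι] (ν : ι → Measure ℂ) [∀ i, SigmaFinite (ν i)]
    [∀ i, NullSingletonClass (ν i)] {p : MvPolynomial ι ℂ} (hp : p ≠ 0) :
    ∀ᵐ x ∂Measure.pi ν, MvPolynomial.eval x p ≠ 0 := by
  set e := (Fintype.equivFin ι).symm
  have hm := measurePreserving_piCongrLeft ν e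
  rw [← hm.map_eq, ae_map_iff hm.measurable.aemeasurable
      (measurableSet_eval_ne_zero p)]
  have h0 : MvPolynomial.rename e.symm p ≠ 0 := by
    simpa using (MvPolynomial.rename_injective _ e.symm.injective).ne hp
  filter_upwards [ae_eval_ne_zero_fin (fun j => ν (e j)) h0] with x hx
  rw [MvPolynomial.eval_rename] at hx
  have h1 : MeasurableEquiv.piCongrLeft (fun _ : ι => ℂ) e x = x ∘ e.symm := by
    funext i
    obtain ⟨j, rfl⟩ := e.surjective i
    simp [MeasurableEquiv.piCongrLeft, Equiv.piCongrLeft_apply_apply]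
  rwa [h1]

/-! ### Complex Gaussian laws -/

theorem measurable_complexMk : Measurable (fun p : ℝ × ℝ => (⟨p.1, p.2⟩ : ℂ)) :=
  Complex.measurableEquivRealProd.symm.measurable

instance isProbabilityMeasure_complexGaussian (v : ℝ≥0) :
    IsProbabilityMeasure (complexGaussian v) :=
  Measure.isProbabilityMeasure_map measurable_complexMk.aemeasurable

theorem nullSingletonClass_complexGaussian {v : ℝ≥0} (hv : v ≠ 0) : NullSingletonClass (complexGaussian v) := by
  have : NullSingletonClass (gaussianReal 0 (v / 2)) := nullSingletonClass_gaussianReal (by positivity)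
  refine ⟨fun z => ?_⟩
  rw [complexGaussian, Measure.map_apply measurable_complexMk (measurableSet_singleton z)]
  refine measure_mono_null (t := {z.re} ×ˢ {z.im}) ?_
    (by simp)
  rintro ⟨x, y⟩ h
  simp only [Set.mem_preimage, Set.mem_singleton_iff] at h
  simp [← h]

theorem charFun_complexGaussian (v : ℝ≥0) (t : ℂ) :
    charFun (complexGaussian v) t = Complex.exp (-(v * ‖t‖ ^ 2 / 4 : ℝ)) := by
  have h1 : charFun (complexGaussian v) t =
      charFun (gaussianReal 0 (v / 2)) t.re * charFun (gaussianReal 0 (v / 2)) t.im := by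
    rw [charFun_apply, complexGaussian, integral_map measurable_complexMk.aemeasurable
      (by fun_prop), charFun_apply, charFun_apply, ← integral_prod_mul]
    refine integral_congr_ae (Filter.Eventually.of_forall fun p => ?_)
    simp only [Complex.inner, ← Complex.exp_add]
    congr 1
    simp
    ring
  rw [h1, charFun_gaussianReal, charFun_gaussianReal, ← Complex.exp_add,
    Complex.sq_norm, Complex.normSq_apply]
  congr 1
  push_cast
  ring

/-- A product of centred complex Gaussian laws is invariant under a map whose adjoint preserves
the covariance form. -/
theorem map_pi_complexGaussian {ι : Type*} [Fintype ι] (v : ι → ℝ≥0)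
    (T T' : (ι → ℂ) → ι → ℂ) (hT : Measurable T)
    (hadj : ∀ x t, ∑ i, t i * star (T x i) = ∑ i, T' t i * star (x i))
    (hiso : ∀ t, ∑ i, v i * ‖T' t i‖ ^ 2 = ∑ i, v i * ‖t i‖ ^ 2) :
    (Measure.pi fun i => complexGaussian (v i)).map T =
      Measure.pi fun i => complexGaussian (v i) := by
  have : IsFiniteMeasure ((Measure.pi fun i => complexGaussian (v i)).map T) :=
    Measure.isFiniteMeasure_map _ _
  rw [← charFun_eq_pi_iff]
  intro t
  have h2 := charFun_pi (μ := fun i => complexGaussian (v i)) (WithLp.toLp 2 (T' t.ofLp))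
  -- The adjoint relation moves `T` onto the frequency variable; what remains depends on `t` only
  -- through the form preserved by `hiso`.
  have h3 : charFun (((Measure.pi fun i => complexGaussian (v i)).map T).map (WithLp.toLp 2)) t
      = charFun ((Measure.pi fun i => complexGaussian (v i)).map (WithLp.toLp 2))
        (WithLp.toLp 2 (T' t.ofLp)) := by
    rw [charFun_apply, charFun_apply, Measure.map_map (by fun_prop) hT,
      integral_map (by fun_prop) (by fun_prop), integral_map (by fun_prop) (by fun_prop)]
    refine integral_congr_ae (Filter.Eventually.of_forall fun x => ?_)
    have := congrArg Complex.re (hadj x t.ofLp)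
    simp only [Complex.re_sum] at this
    simp only [PiLp.inner_apply, Complex.inner, Function.comp_apply]
    simp only [RCLike.star_def] at this
    rw [this]
  rw [h3, h2]
  simp only [charFun_complexGaussian, ← Complex.exp_sum]
  congr 1
  have := hiso t.ofLp
  simp only [← Complex.ofReal_neg, ← Complex.ofReal_sum]
  congr 1
  simp only [Finset.sum_neg_distrib, ← Finset.sum_div, this]

/-! ### Unitary matrices and uniqueness of the uniform law on the sphere -/

theorem conjTranspose_mem_unitaryGroup {n : ℕ} {U : Matrix (Fin n) (Fin n) ℂ}
    (hU : U ∈ Matrix.unitaryGroup (Fin n) ℂ) : Uᴴ ∈ Matrix.unitaryGroup (Fin n) ℂ :=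
  Unitary.star_mem hU

theorem conjTranspose_mul_self_of_unitary {n : ℕ} {U : Matrix (Fin n) (Fin n) ℂ}
    (hU : U ∈ Matrix.unitaryGroup (Fin n) ℂ) : Uᴴ * U = 1 :=
  Matrix.mem_unitaryGroup_iff'.mp hU

theorem mul_conjTranspose_self_of_unitary {n : ℕ} {U : Matrix (Fin n) (Fin n) ℂ}
    (hU : U ∈ Matrix.unitaryGroup (Fin n) ℂ) : U * Uᴴ = 1 :=
  Matrix.mem_unitaryGroup_iff.mp hU

theorem dotProduct_star_mulVec {n : ℕ} (U : Matrix (Fin n) (Fin n) ℂ) (t x : Fin n → ℂ) :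
    t ⬝ᵥ star (U *ᵥ x) = (Uᴴ *ᵥ t) ⬝ᵥ star x := by
  rw [Matrix.star_mulVec, dotProduct_comm, ← Matrix.dotProduct_mulVec, dotProduct_comm]

theorem sum_norm_sq_mulVec {n : ℕ} {U : Matrix (Fin n) (Fin n) ℂ}
    (hU : U ∈ Matrix.unitaryGroup (Fin n) ℂ) (w : Fin n → ℂ) :
    ∑ i, ‖(U *ᵥ w) i‖ ^ 2 = ∑ i, ‖w i‖ ^ 2 := by
  have key (u : Fin n → ℂ) : ((∑ i, ‖u i‖ ^ 2 : ℝ) : ℂ) = u ⬝ᵥ star u := by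
    simp [dotProduct, Complex.mul_conj']
  have h : (U *ᵥ w) ⬝ᵥ star (U *ᵥ w) = w ⬝ᵥ star w := by
    rw [dotProduct_star_mulVec, Matrix.mulVec_mulVec, conjTranspose_mul_self_of_unitary hU,
      Matrix.one_mulVec]
  rw [← key, ← key] at h
  exact_mod_cast h

theorem norm_toLp_mulVec {n : ℕ} {U : Matrix (Fin n) (Fin n) ℂ}
    (hU : U ∈ Matrix.unitaryGroup (Fin n) ℂ) (w : Fin n → ℂ) :
    ‖WithLp.toLp 2 (U *ᵥ w)‖ = ‖WithLp.toLp 2 w‖ := by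
  rw [EuclideanSpace.norm_eq, EuclideanSpace.norm_eq]
  exact congrArg _ (sum_norm_sq_mulVec hU w)

theorem real_inner_eq_re_dotProduct {n : ℕ} (x t : EuclideanSpace ℂ (Fin n)) :
    inner ℝ x t = (t.ofLp ⬝ᵥ star x.ofLp).re := by
  simp [PiLp.inner_apply, Complex.inner, dotProduct]

theorem measurable_toLp_mulVec {n : ℕ} (U : Matrix (Fin n) (Fin n) ℂ) :
    Measurable fun x : EuclideanSpace ℂ (Fin n) => WithLp.toLp 2 (U *ᵥ x.ofLp) := by
  refine (WithLp.measurable_toLp 2 _).comp (measurable_pi_iff.mpr fun i => ?_)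
  simp only [Matrix.mulVec, dotProduct]
  fun_prop

/-- Every unit vector is the image of a basis vector under a unitary matrix. -/
theorem exists_unitary_mulVec_single {n : ℕ} (i₀ : Fin n) (a : EuclideanSpace ℂ (Fin n))
    (ha : ‖a‖ = 1) :
    ∃ U ∈ Matrix.unitaryGroup (Fin n) ℂ, U *ᵥ Pi.single i₀ 1 = a.ofLp := by
  -- The single vector `a`, placed at index `i₀`, extends to an orthonormal basis, whose vectors are
  -- the columns of `U`.
  have hort : Orthonormal ℂ (Set.domRestrict {i₀} (fun _ : Fin n => a)) := by
    refine ⟨fun _ => ha, fun i j hij => (hij (Subsingleton.elim i j)).elim⟩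
  obtain ⟨b, hb⟩ := hort.exists_orthonormalBasis_extension_of_card_eq (by simp)
  refine ⟨Matrix.of fun i j => b j i, ?_, ?_⟩
  · rw [Matrix.mem_unitaryGroup_iff']
    ext i j
    have := orthonormal_iff_ite.mp b.orthonormal i j
    rw [PiLp.inner_apply] at this
    simp only [RCLike.inner_apply] at this
    rw [Matrix.one_apply, ← this]
    simp [Matrix.mul_apply, Matrix.star_apply, mul_comm]
  · rw [Matrix.mulVec_single_one]
    ext i
    simp [hb i₀ rfl]

/-- Both directions are images of the same basis vector, so one unitary composed with the inverse of
the other works. -/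
theorem exists_unitary_mulVec_eq {n : ℕ} {a b : EuclideanSpace ℂ (Fin n)} (h : ‖a‖ = ‖b‖) :
    ∃ U ∈ Matrix.unitaryGroup (Fin n) ℂ, WithLp.toLp 2 (U *ᵥ a.ofLp) = b := by
  by_cases ha : a = 0
  · have hb : b = 0 := by simpa [ha] using h.symm
    exact ⟨1, one_mem _, by simp [ha, hb]⟩
  have hna : ‖a‖ ≠ 0 := norm_ne_zero_iff.mpr ha
  have hnb : ‖b‖ ≠ 0 := h ▸ hna
  obtain ⟨i₀⟩ : Nonempty (Fin n) := by
    by_contra hn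
    rw [not_nonempty_iff] at hn
    exact ha (by ext i; exact hn.elim i)
  obtain ⟨V, hV, hVa⟩ := exists_unitary_mulVec_single i₀ (((‖a‖⁻¹ : ℝ) : ℂ) • a)
    (by simp [norm_smul, hna])
  obtain ⟨U, hU, hUb⟩ := exists_unitary_mulVec_single i₀ (((‖b‖⁻¹ : ℝ) : ℂ) • b)
    (by simp [norm_smul, hnb])
  refine ⟨U * Vᴴ, mul_mem hU (conjTranspose_mem_unitaryGroup hV), ?_⟩
  have h1 : Vᴴ *ᵥ (((‖a‖⁻¹ : ℝ) : ℂ) • a).ofLp = Pi.single i₀ 1 := by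
    rw [← hVa, Matrix.mulVec_mulVec, conjTranspose_mul_self_of_unitary hV, Matrix.one_mulVec]
  have h2 : (U * Vᴴ) *ᵥ (((‖a‖⁻¹ : ℝ) : ℂ) • a).ofLp = (((‖b‖⁻¹ : ℝ) : ℂ) • b).ofLp := by
    rw [← Matrix.mulVec_mulVec, h1, hUb]
  rw [WithLp.ofLp_smul, WithLp.ofLp_smul, Matrix.mulVec_smul, h] at h2
  have h3 : (((‖b‖⁻¹ : ℝ) : ℂ)) ≠ 0 := by simpa using hnb
  have h4 := smul_right_injective _ h3 h2
  rw [h4]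

/-- Two unitarily invariant probability measures carried by the unit sphere agree. -/
theorem eq_of_unitary_invariant_of_norm_eq_one {n : ℕ}
    {ν₁ ν₂ : Measure (EuclideanSpace ℂ (Fin n))}
    [IsProbabilityMeasure ν₁] [IsProbabilityMeasure ν₂]
    (h₁ : ∀ U ∈ Matrix.unitaryGroup (Fin n) ℂ,
      ν₁.map (fun x => WithLp.toLp 2 (U *ᵥ x.ofLp)) = ν₁)
    (h₂ : ∀ U ∈ Matrix.unitaryGroup (Fin n) ℂ,
      ν₂.map (fun x => WithLp.toLp 2 (U *ᵥ x.ofLp)) = ν₂)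
    (hn₁ : ∀ᵐ x ∂ν₁, ‖x‖ = 1) (hn₂ : ∀ᵐ x ∂ν₂, ‖x‖ = 1) : ν₁ = ν₂ := by
  -- Invariance makes the characteristic function radial.
  have inv (ν : Measure (EuclideanSpace ℂ (Fin n)))
      (h : ∀ U ∈ Matrix.unitaryGroup (Fin n) ℂ,
        ν.map (fun x => WithLp.toLp 2 (U *ᵥ x.ofLp)) = ν)
      (a b : EuclideanSpace ℂ (Fin n)) (hab : ‖a‖ = ‖b‖) : charFun ν a = charFun ν b := by
    obtain ⟨U, hU, rfl⟩ := exists_unitary_mulVec_eq hab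
    conv_rhs => rw [← h U hU]
    rw [charFun_apply, charFun_apply, integral_map (measurable_toLp_mulVec U).aemeasurable
      (by fun_prop)]
    refine integral_congr_ae (Filter.Eventually.of_forall fun x => ?_)
    simp only [real_inner_eq_re_dotProduct, dotProduct_star_mulVec, Matrix.mulVec_mulVec,
      conjTranspose_mul_self_of_unitary hU, Matrix.one_mulVec]
  refine Measure.ext_of_charFun (funext fun t => ?_)
  set F : EuclideanSpace ℂ (Fin n) → EuclideanSpace ℂ (Fin n) → ℂ :=
    fun x y => Complex.exp ((inner ℝ x (‖t‖ • y) : ℝ) * Complex.I) with hF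
  have hsymm (x y) : F x y = F y x := by
    simp only [hF, inner_smul_right, real_inner_comm]
  -- For `‖y‖ = 1` the frequency `‖t‖ • y` has the norm of `t`, so averaging over `y` changes
  -- nothing. As `F` is symmetric, Fubini then exchanges the two measures.
  have one (ν₁ ν₂ : Measure (EuclideanSpace ℂ (Fin n)))
      [IsProbabilityMeasure ν₂]
      (h : ∀ U ∈ Matrix.unitaryGroup (Fin n) ℂ,
        ν₁.map (fun x => WithLp.toLp 2 (U *ᵥ x.ofLp)) = ν₁) (hn₂ : ∀ᵐ x ∂ν₂, ‖x‖ = 1) :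
      ∫ y, ∫ x, F x y ∂ν₁ ∂ν₂ = charFun ν₁ t := by
    have : (fun y => ∫ x, F x y ∂ν₁) =ᵐ[ν₂] fun _ => charFun ν₁ t := by
      filter_upwards [hn₂] with y hy
      exact inv ν₁ h _ _ (by simp [norm_smul, hy])
    rw [integral_congr_ae this]
    simp
  rw [← one ν₁ ν₂ h₁ hn₂, ← one ν₂ ν₁ h₂ hn₁, integral_integral_swap]
  · simp only [hsymm]
  · refine Integrable.of_bound (C := 1) (Continuous.aestronglyMeasurable ?_) ?_
    · simp only [Function.uncurry_def, hF]
      fun_prop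
    · exact Filter.Eventually.of_forall fun p => by
        simp [hF, Function.uncurry_def, Complex.norm_exp_ofReal_mul_I]

/-! ### Gaussian vectors and matrices -/

instance isProbabilityMeasure_stdComplexGaussianVec (n : ℕ) :
    IsProbabilityMeasure (stdComplexGaussianVec n) :=
  Measure.isProbabilityMeasure_map (WithLp.measurable_toLp 2 _).aemeasurable

theorem map_mulVec_stdComplexGaussianVec {n : ℕ} {U : Matrix (Fin n) (Fin n) ℂ}
    (hU : U ∈ Matrix.unitaryGroup (Fin n) ℂ) :
    (stdComplexGaussianVec n).map (fun x => WithLp.toLp 2 (U *ᵥ x.ofLp)) =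
      stdComplexGaussianVec n := by
  have hm : Measurable fun x : Fin n → ℂ => U *ᵥ x := by
    refine measurable_pi_iff.mpr fun i => ?_
    simp only [Matrix.mulVec, dotProduct]
    fun_prop
  have h := map_pi_complexGaussian (fun _ : Fin n => 1) (fun x => U *ᵥ x) (fun t => Uᴴ *ᵥ t) hm
    (fun x t => dotProduct_star_mulVec U t x)
    (fun t => by simpa using sum_norm_sq_mulVec (conjTranspose_mem_unitaryGroup hU) t)
  conv_rhs => rw [stdComplexGaussianVec, ← h]
  rw [stdComplexGaussianVec, Measure.map_map (measurable_toLp_mulVec U)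
    (WithLp.measurable_toLp 2 _), Measure.map_map (WithLp.measurable_toLp 2 _) hm]
  rfl

/-- The law of a random matrix with independent entries, those of column `j` being
`CN(0, v j)`. -/
noncomputable def gaussianMatrix {J : Type*} [Fintype J] (N : ℕ) (v : J → ℝ≥0) : Measure (Matrix (Fin N) J ℂ) :=
  (Measure.pi fun q : Fin N × J => complexGaussian (v q.2)).map
    fun x => Matrix.of fun i j => x (i, j)

theorem measurable_matrix_of_prod {J : Type*} (N : ℕ) :
    Measurable fun x : Fin N × J → ℂ => (Matrix.of fun i j => x (i, j) : Matrix (Fin N) J ℂ) :=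
  measurable_pi_iff.mpr fun i => measurable_pi_iff.mpr fun j => measurable_pi_apply (i, j)

instance isProbabilityMeasure_gaussianMatrix {J : Type*} [Fintype J] (N : ℕ) (v : J → ℝ≥0) :
    IsProbabilityMeasure (gaussianMatrix N v) :=
  Measure.isProbabilityMeasure_map (measurable_matrix_of_prod N).aemeasurable

/-! ### Measurability of matrix operations -/

theorem measurable_matrix_entry {m n : Type*} (i : m) (j : n) :
    Measurable fun A : Matrix m n ℂ => A i j :=
  (measurable_pi_apply j).comp (measurable_pi_apply i)

theorem measurable_matrix_mk {α m n : Type*} [MeasurableSpace α] {A : α → Matrix m n ℂ}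
    (h : ∀ i j, Measurable fun a => A a i j) : Measurable A :=
  measurable_pi_iff.mpr fun i => measurable_pi_iff.mpr fun j => h i j

theorem Measurable.matrix_entry {α m n : Type*} [MeasurableSpace α] {A : α → Matrix m n ℂ}
    (h : Measurable A) (i : m) (j : n) : Measurable fun a => A a i j :=
  (measurable_matrix_entry i j).comp h

theorem Measurable.matrix_mul {α l m n : Type*} [Fintype m] [MeasurableSpace α]
    {A : α → Matrix l m ℂ} {B : α → Matrix m n ℂ} (hA : Measurable A) (hB : Measurable B) :
    Measurable fun a => A a * B a := by
  refine measurable_matrix_mk fun i j => ?_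
  simp only [Matrix.mul_apply]
  exact Finset.measurable_sum _ fun k _ => (hA.matrix_entry i k).mul (hB.matrix_entry k j)

theorem Measurable.matrix_conjTranspose {α m n : Type*} [MeasurableSpace α]
    {A : α → Matrix m n ℂ} (hA : Measurable A) : Measurable fun a => (A a)ᴴ := by
  refine measurable_matrix_mk fun i j => ?_
  simp only [Matrix.conjTranspose_apply]
  exact continuous_star.measurable.comp (hA.matrix_entry j i)

theorem Measurable.matrix_inv {α m : Type*} [Fintype m] [DecidableEq m] [MeasurableSpace α]
    {A : α → Matrix m m ℂ} (hA : Measurable A) : Measurable fun a => (A a)⁻¹ := by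
  have hdet {B : α → Matrix m m ℂ} (hB : Measurable B) : Measurable fun a => (B a).det := by
    simp only [Matrix.det_apply]
    refine Finset.measurable_sum _ fun σ _ => Measurable.const_smul ?_ _
    exact Finset.measurable_prod _ fun i _ => hB.matrix_entry _ _
  refine measurable_matrix_mk fun i j => ?_
  simp only [Matrix.inv_def, Matrix.smul_apply, Ring.inverse_eq_inv', smul_eq_mul,
    Matrix.adjugate_apply]
  refine (hdet hA).inv.mul (hdet (measurable_matrix_mk fun i' j' => ?_))
  simp only [Matrix.updateRow_apply]
  split_ifs
  · exact measurable_const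
  · exact hA.matrix_entry _ _

/-- `U` acts on each column separately and the variance is constant within a column, so the
covariance form is preserved even when variances differ between columns. -/
theorem map_mul_gaussianMatrix {N : ℕ} {J : Type*} [Fintype J] (v : J → ℝ≥0)
    {U : Matrix (Fin N) (Fin N) ℂ} (hU : U ∈ Matrix.unitaryGroup (Fin N) ℂ) :
    (gaussianMatrix N v).map (fun B => U * B) = gaussianMatrix N v := by
  set T : Matrix (Fin N) (Fin N) ℂ → (Fin N × J → ℂ) → Fin N × J → ℂ :=
    fun V x q => (V *ᵥ fun i => x (i, q.2)) q.1 with hTdef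
  have hm : Measurable (T U) := by
    refine measurable_pi_iff.mpr fun q => ?_
    simp only [hTdef, Matrix.mulVec, dotProduct]
    fun_prop
  have h := map_pi_complexGaussian (fun q : Fin N × J => v q.2) (T U) (T Uᴴ) hm
    (fun x t => by
      rw [Fintype.sum_prod_type_right, Fintype.sum_prod_type_right]
      exact Finset.sum_congr rfl fun j _ =>
        dotProduct_star_mulVec U (fun i => t (i, j)) (fun i => x (i, j)))
    (fun t => by
      rw [Fintype.sum_prod_type_right, Fintype.sum_prod_type_right]
      refine Finset.sum_congr rfl fun j _ => ?_
      simp only [← Finset.mul_sum]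
      exact congrArg _ (sum_norm_sq_mulVec (conjTranspose_mem_unitaryGroup hU) fun i => t (i, j)))
  conv_rhs => rw [gaussianMatrix, ← h]
  have hmul : Measurable fun B : Matrix (Fin N) J ℂ => U * B :=
    measurable_const.matrix_mul measurable_id
  rw [gaussianMatrix, Measure.map_map hmul (measurable_matrix_of_prod N), Measure.map_map (measurable_matrix_of_prod N) hm]
  rfl

/-! ### Normalization and the receive beamformer -/

theorem measurable_unitVec {n : ℕ} : Measurable (unitVec (n := n)) := by
  unfold unitVec
  fun_prop

theorem norm_unitVec {n : ℕ} {z : EuclideanSpace ℂ (Fin n)} (hz : z ≠ 0) : ‖unitVec z‖ = 1 := by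
  simp [unitVec, norm_smul, hz]

theorem unitVec_smul {n : ℕ} {c : ℝ} (hc : 0 < c) (z : EuclideanSpace ℂ (Fin n)) :
    unitVec ((c : ℂ) • z) = unitVec z := by
  have hc' : (c : ℂ) ≠ 0 := by exact_mod_cast hc.ne'
  simp only [unitVec, norm_smul, smul_smul, Complex.norm_real, Real.norm_eq_abs, abs_of_pos hc]
  congr 1
  push_cast
  field_simp

theorem unitVec_zero {n : ℕ} : unitVec (0 : EuclideanSpace ℂ (Fin n)) = 0 := by
  simp [unitVec]

theorem unitVec_unitVec {n : ℕ} (z : EuclideanSpace ℂ (Fin n)) :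
    unitVec (unitVec z) = unitVec z := by
  by_cases hz : z = 0
  · simp [hz, unitVec_zero]
  · exact unitVec_smul (by positivity) z

theorem unitVec_mulVec_of_unitary {n : ℕ} {U : Matrix (Fin n) (Fin n) ℂ}
    (hU : U ∈ Matrix.unitaryGroup (Fin n) ℂ) (z : EuclideanSpace ℂ (Fin n)) :
    unitVec (WithLp.toLp 2 (U *ᵥ z.ofLp)) = WithLp.toLp 2 (U *ᵥ (unitVec z).ofLp) := by
  simp only [unitVec, norm_toLp_mulVec hU, WithLp.ofLp_smul, Matrix.mulVec_smul,
    WithLp.toLp_smul, WithLp.toLp_ofLp]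

/-- This is what makes only the direction of the channel vector matter. The default `unitVec 0 = 0`
covers `z = 0`. -/
theorem receiveBeamformer_unitVec {n : ℕ} (W : Matrix (Fin n) (Fin n) ℂ)
    (z : EuclideanSpace ℂ (Fin n)) :
    receiveBeamformer W (unitVec z) = receiveBeamformer W z := by
  by_cases hz : z = 0
  · simp [hz, unitVec_zero]
  · simp only [receiveBeamformer]
    rw [← unitVec_smul (c := 1 / ‖z‖) (by positivity) (WithLp.toLp 2 (W *ᵥ z.ofLp))]
    simp only [unitVec, WithLp.ofLp_smul, Matrix.mulVec_smul, WithLp.toLp_smul]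

theorem Measurable.receiveBeamformer {α : Type*} [MeasurableSpace α] {n : ℕ}
    {W : α → Matrix (Fin n) (Fin n) ℂ} {h : α → EuclideanSpace ℂ (Fin n)}
    (hW : Measurable W) (hh : Measurable h) :
    Measurable fun a => receiveBeamformer (W a) (h a) := by
  refine measurable_unitVec.comp ((WithLp.measurable_toLp 2 _).comp
    (measurable_pi_iff.mpr fun i => ?_))
  simp only [Matrix.mulVec, dotProduct]
  refine Finset.measurable_sum _ fun j _ => (hW.matrix_entry i j).mul ?_
  fun_prop

/-- A nonzero row of `W` is a nonzero linear form, hence a nonzero polynomial. -/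
theorem ae_mulVec_ne_zero {n : ℕ} {W : Matrix (Fin n) (Fin n) ℂ} (hW : W ≠ 0) :
    ∀ᵐ z ∂stdComplexGaussianVec n, WithLp.toLp 2 (W *ᵥ z.ofLp) ≠ 0 := by
  obtain ⟨i, j, hij⟩ : ∃ i j, W i j ≠ 0 := by
    by_contra! h
    exact hW (Matrix.ext h)
  have : NullSingletonClass (complexGaussian 1) :=
    nullSingletonClass_complexGaussian one_ne_zero
  set p : MvPolynomial (Fin n) ℂ := ∑ l, MvPolynomial.C (W i l) * MvPolynomial.X l with hp
  have heval (x : Fin n → ℂ) : MvPolynomial.eval x p = (W *ᵥ x) i := by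
    simp [hp, Matrix.mulVec, dotProduct]
  have hp0 : p ≠ 0 := by
    intro h0
    have := heval (Pi.single j 1)
    rw [h0] at this
    simp at this
    exact hij this.symm
  have hms : MeasurableSet {z : EuclideanSpace ℂ (Fin n) | WithLp.toLp 2 (W *ᵥ z.ofLp) ≠ 0} :=
    measurable_toLp_mulVec W (measurableSet_singleton 0).compl
  rw [stdComplexGaussianVec, ae_map_iff (WithLp.measurable_toLp 2 _).aemeasurable hms]
  filter_upwards [ae_eval_ne_zero (fun _ : Fin n => complexGaussian 1) hp0] with x hx h0
  rw [heval] at hx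
  exact hx (congrFun ((WithLp.toLp_eq_zero 2).mp h0) i)

instance isProbabilityMeasure_normalizedComplexGaussian (n : ℕ) :
    IsProbabilityMeasure (normalizedComplexGaussian n) :=
  Measure.isProbabilityMeasure_map measurable_unitVec.aemeasurable

theorem map_unitVec_normalizedComplexGaussian (n : ℕ) :
    (normalizedComplexGaussian n).map unitVec = normalizedComplexGaussian n := by
  rw [normalizedComplexGaussian, Measure.map_map measurable_unitVec measurable_unitVec]
  congr 1
  exact funext unitVec_unitVec

theorem map_mulVec_normalizedComplexGaussian {n : ℕ} {U : Matrix (Fin n) (Fin n) ℂ}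
    (hU : U ∈ Matrix.unitaryGroup (Fin n) ℂ) :
    (normalizedComplexGaussian n).map (fun x => WithLp.toLp 2 (U *ᵥ x.ofLp)) =
      normalizedComplexGaussian n := by
  conv_rhs => rw [normalizedComplexGaussian, ← map_mulVec_stdComplexGaussianVec hU]
  rw [normalizedComplexGaussian, Measure.map_map (measurable_toLp_mulVec U) measurable_unitVec,
    Measure.map_map measurable_unitVec (measurable_toLp_mulVec U)]
  congr 1
  exact funext fun z => (unitVec_mulVec_of_unitary hU z).symm

theorem ae_norm_normalizedComplexGaussian {n : ℕ} (hn : n ≠ 0) :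
    ∀ᵐ x ∂normalizedComplexGaussian n, ‖x‖ = 1 := by
  have : NeZero n := ⟨hn⟩
  have hms : MeasurableSet {x : EuclideanSpace ℂ (Fin n) | ‖x‖ = 1} :=
    measurable_norm (measurableSet_singleton 1)
  rw [normalizedComplexGaussian, ae_map_iff measurable_unitVec.aemeasurable hms]
  filter_upwards [ae_mulVec_ne_zero (one_ne_zero : (1 : Matrix (Fin n) (Fin n) ℂ) ≠ 0)] with z hz
  exact norm_unitVec (by simpa using hz)

/-- The direction `W z / ‖W z‖` of a Gaussian vector `z` under an independent, unitarily
equivariant and nowhere vanishing function `W` of a Gaussian matrix is uniformly distributed. -/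
theorem map_receiveBeamformer_gaussian {N : ℕ} {J : Type*} [Fintype J] (v : J → ℝ≥0)
    {f : Matrix (Fin N) J ℂ → Matrix (Fin N) (Fin N) ℂ} (hf : Measurable f)
    (hequiv : ∀ U ∈ Matrix.unitaryGroup (Fin N) ℂ, ∀ B, f (U * B) = U * f B * Uᴴ)
    (hne : ∀ B, f B ≠ 0) :
    ((gaussianMatrix N v).prod (stdComplexGaussianVec N)).map
      (fun p => receiveBeamformer (f p.1) p.2) = normalizedComplexGaussian N := by
  have hN : N ≠ 0 := by
    rintro rfl
    exact hne 0 (Subsingleton.elim _ _)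
  have hm : Measurable fun p : Matrix (Fin N) J ℂ × EuclideanSpace ℂ (Fin N) =>
      receiveBeamformer (f p.1) p.2 :=
    (hf.comp measurable_fst).receiveBeamformer measurable_snd
  have : IsProbabilityMeasure (((gaussianMatrix N v).prod (stdComplexGaussianVec N)).map
      (fun p => receiveBeamformer (f p.1) p.2)) := Measure.isProbabilityMeasure_map hm.aemeasurable
  refine eq_of_unitary_invariant_of_norm_eq_one (fun U hU => ?_)
    (fun U hU => map_mulVec_normalizedComplexGaussian hU) ?_ (ae_norm_normalizedComplexGaussian hN)
  · have hmul : Measurable fun B : Matrix (Fin N) J ℂ => U * B :=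
      measurable_const.matrix_mul measurable_id
    -- Rotating both factors keeps the product law, and `f (U * B) *ᵥ (U *ᵥ z) = U *ᵥ (f B *ᵥ z)`.
    have hprod := Measure.map_prod_map (gaussianMatrix N v) (stdComplexGaussianVec N) hmul
      (measurable_toLp_mulVec U)
    rw [map_mul_gaussianMatrix v hU, map_mulVec_stdComplexGaussianVec hU] at hprod
    conv_rhs => rw [hprod]
    rw [Measure.map_map (measurable_toLp_mulVec U) hm,
      Measure.map_map hm (hmul.prodMap (measurable_toLp_mulVec U))]
    congr 1
    funext p
    simp only [Function.comp_apply, Prod.map, receiveBeamformer, hequiv U hU,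
      Matrix.mulVec_mulVec, Matrix.mul_assoc, conjTranspose_mul_self_of_unitary hU,
      Matrix.mul_one]
    rw [← unitVec_mulVec_of_unitary hU]
    simp only [Matrix.mulVec_mulVec]
  · have hms : MeasurableSet {x : EuclideanSpace ℂ (Fin N) | ‖x‖ = 1} :=
      measurable_norm (measurableSet_singleton 1)
    have hms' : MeasurableSet {p : Matrix (Fin N) J ℂ × EuclideanSpace ℂ (Fin N) |
        ‖receiveBeamformer (f p.1) p.2‖ = 1} := hm hms
    rw [ae_map_iff hm.aemeasurable hms, Measure.ae_prod_iff_ae_ae hms']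
    exact Filter.Eventually.of_forall fun B =>
      (ae_mulVec_ne_zero (hne B)).mono fun z hz => norm_unitVec hz

/-! ### Unitary invariance of equivariant filters -/

/-- Deterministic unitaries suffice: by independence the joint law of `G` and `W` is a product, and
for each fixed value of `G` the inner integral is the same. -/
theorem isUnitarilyInvariant_of_map_eq {Ω : Type*} [MeasurableSpace Ω] (μ : Measure Ω)
    [IsProbabilityMeasure μ] {n : ℕ} {W : Ω → Matrix (Fin n) (Fin n) ℂ} (hW : Measurable W)
    (hherm : ∀ ω, (W ω).IsHermitian)
    (hinv : ∀ U ∈ Matrix.unitaryGroup (Fin n) ℂ,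
      μ.map (fun ω => U * W ω * Uᴴ) = μ.map W) : IsUnitarilyInvariant μ W := by
  refine ⟨Filter.Eventually.of_forall hherm, fun G hG hGU hind => ?_⟩
  have hconj : Measurable fun p : Matrix (Fin n) (Fin n) ℂ × Matrix (Fin n) (Fin n) ℂ =>
      p.1 * p.2 * p.1ᴴ :=
    (measurable_fst.matrix_mul measurable_snd).matrix_mul measurable_fst.matrix_conjTranspose
  have hGW : Measurable fun ω => G ω * W ω * (G ω)ᴴ :=
    (hG.matrix_mul hW).matrix_mul hG.matrix_conjTranspose
  refine ⟨hW.aemeasurable, hGW.aemeasurable, ?_⟩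
  have hjoint := (indepFun_iff_map_prod_eq_prod_map_map hG.aemeasurable hW.aemeasurable).mp hind
  have : μ.map (fun ω => G ω * W ω * (G ω)ᴴ) =
      ((μ.map G).prod (μ.map W)).map (fun p => p.1 * p.2 * p.1ᴴ) := by
    rw [← hjoint, Measure.map_map hconj (hG.prodMk hW)]
    rfl
  rw [this]
  have : IsProbabilityMeasure (μ.map W) := Measure.isProbabilityMeasure_map hW.aemeasurable
  ext s hs
  rw [Measure.map_apply hconj hs, Measure.prod_apply (hconj hs),
    lintegral_map (measurable_measure_prodMk_left (hconj hs)) hG]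
  have hconst (ω : Ω) : (μ.map W) (Prod.mk (G ω) ⁻¹' ((fun p => p.1 * p.2 * p.1ᴴ) ⁻¹' s)) =
      (μ.map W) s := by
    conv_rhs => rw [← hinv (G ω) (hGU ω)]
    have h1 : Measurable fun ω' => G ω * W ω' * (G ω)ᴴ :=
      (measurable_const.matrix_mul hW).matrix_mul measurable_const
    rw [Measure.map_apply hW (measurable_prodMk_left (hconj hs)),
      Measure.map_apply h1 hs]
    rfl
  simp [hconst]

theorem isUnitarilyInvariant_of_equivariant {Ω : Type*} [MeasurableSpace Ω] (μ : Measure Ω)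
    [IsProbabilityMeasure μ] {N : ℕ} {J : Type*} [Fintype J] (v : J → ℝ≥0)
    {B : Ω → Matrix (Fin N) J ℂ} (hB : Measurable B) (hlaw : μ.map B = gaussianMatrix N v)
    {f : Matrix (Fin N) J ℂ → Matrix (Fin N) (Fin N) ℂ} (hf : Measurable f)
    (hherm : ∀ B, (f B).IsHermitian)
    (hequiv : ∀ U ∈ Matrix.unitaryGroup (Fin N) ℂ, ∀ B, f (U * B) = U * f B * Uᴴ) :
    IsUnitarilyInvariant μ (fun ω => f (B ω)) := by
  refine isUnitarilyInvariant_of_map_eq μ (hf.comp hB) (fun ω => hherm _) fun U hU => ?_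
  have hmul : Measurable fun B : Matrix (Fin N) J ℂ => U * B :=
    measurable_const.matrix_mul measurable_id
  simp only [← hequiv U hU]
  have h1 : μ.map (fun ω => f (U * B ω)) = ((μ.map B).map (fun B => U * B)).map f := by
    rw [Measure.map_map hf hmul, Measure.map_map (hf.comp hmul) hB]
    rfl
  rw [h1, hlaw, map_mul_gaussianMatrix v hU, ← hlaw, Measure.map_map hf hB]
  rfl

/-! ### Full rank, and the law of the beamformer -/

open scoped ComplexOrder in
/-- A tall matrix with independent Gaussian entries almost surely has full column rank. -/
theorem ae_isUnit_gram_gaussianMatrix {N : ℕ} {J : Type*} [Fintype J] [DecidableEq J]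
    {v : J → ℝ≥0} (hv : ∀ j, v j ≠ 0) (hJ : Fintype.card J ≤ N) :
    ∀ᵐ B ∂gaussianMatrix N v, IsUnit (Bᴴ * B) := by
  obtain ⟨e⟩ : Nonempty (J ↪ Fin N) :=
    Function.Embedding.nonempty_of_card_le (by simpa using hJ)
  have (q : Fin N × J) : NullSingletonClass (complexGaussian (v q.2)) :=
    nullSingletonClass_complexGaussian (hv q.2)
  -- The minor on the rows selected by `e`. It equals 1 at the 0-1 matrix tested below, so it is not
  -- the zero polynomial.
  set p : MvPolynomial (Fin N × J) ℂ :=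
    (Matrix.of fun i j => MvPolynomial.X (e i, j) : Matrix J J (MvPolynomial (Fin N × J) ℂ)).det
    with hp
  have heval (x : Fin N × J → ℂ) :
      MvPolynomial.eval x p = (Matrix.of fun i j => x (e i, j) : Matrix J J ℂ).det := by
    rw [hp, RingHom.map_det]
    congr 1
    ext i j
    simp
  have hp0 : p ≠ 0 := by
    intro h0
    have h1 := heval fun q => if q.1 = e q.2 then 1 else 0
    rw [h0, map_zero] at h1
    have h2 : (Matrix.of fun i j => if e i = e j then (1 : ℂ) else 0 : Matrix J J ℂ) = 1 := by
      ext i j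
      simp [Matrix.one_apply]
    rw [h2, Matrix.det_one] at h1
    exact zero_ne_one h1
  have hms : MeasurableSet {B : Matrix (Fin N) J ℂ | IsUnit (Bᴴ * B)} := by
    have hG : Measurable fun B : Matrix (Fin N) J ℂ => (Bᴴ * B) * (Bᴴ * B)⁻¹ :=
      (measurable_id.matrix_conjTranspose.matrix_mul measurable_id).matrix_mul
        (measurable_id.matrix_conjTranspose.matrix_mul measurable_id).matrix_inv
    have hset : {B : Matrix (Fin N) J ℂ | IsUnit (Bᴴ * B)} =
        {B | ∀ i j, ((Bᴴ * B) * (Bᴴ * B)⁻¹) i j = (1 : Matrix J J ℂ) i j} := by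
      ext B
      simp only [Set.mem_ofPred_eq]
      constructor
      · intro h
        rw [Matrix.mul_nonsing_inv _ ((Matrix.isUnit_iff_isUnit_det _).mp h)]
        exact fun _ _ => rfl
      · intro h
        exact IsUnit.of_mul_eq_one _ (Matrix.ext h)
    rw [hset]
    simp only [Set.ofPred_forall]
    exact MeasurableSet.iInter fun i => MeasurableSet.iInter fun j =>
      hG.matrix_entry i j (measurableSet_singleton _)
  rw [gaussianMatrix, ae_map_iff (measurable_matrix_of_prod N).aemeasurable hms]
  filter_upwards [ae_eval_ne_zero (fun q : Fin N × J => complexGaussian (v q.2)) hp0] with x hx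
  rw [heval] at hx
  set B : Matrix (Fin N) J ℂ := Matrix.of fun i j => x (i, j)
  rw [← Matrix.mulVec_injective_iff_isUnit]
  -- The Gram matrix has the same kernel as `B`, and the nonzero minor makes that kernel trivial.
  refine (injective_iff_map_eq_zero (Matrix.mulVecLin (Bᴴ * B))).mpr fun w hw => ?_
  have h1 : B *ᵥ w = 0 := Matrix.conjTranspose_mul_self_mulVec_eq_zero B w |>.mp hw
  refine Matrix.eq_zero_of_mulVec_eq_zero hx (funext fun i => ?_)
  exact congrFun h1 (e i)

/-- The direction of `h` is independent of `B` and distributed as that of a Gaussian vector, so `h`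
can be exchanged for the latter. -/
theorem hasLaw_receiveBeamformer_of_equivariant {Ω : Type*} [MeasurableSpace Ω] (μ : Measure Ω)
    [IsProbabilityMeasure μ] {N : ℕ} {J : Type*} [Fintype J] (v : J → ℝ≥0)
    {B : Ω → Matrix (Fin N) J ℂ} (hB : Measurable B) (hlaw : μ.map B = gaussianMatrix N v)
    {h : Ω → EuclideanSpace ℂ (Fin N)} (hh : Measurable h) (hind : IndepFun B h μ)
    (hdir : μ.map (fun ω => unitVec (h ω)) = normalizedComplexGaussian N)
    {f : Matrix (Fin N) J ℂ → Matrix (Fin N) (Fin N) ℂ} (hf : Measurable f)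
    (hequiv : ∀ U ∈ Matrix.unitaryGroup (Fin N) ℂ, ∀ B, f (U * B) = U * f B * Uᴴ)
    (hne : N ≠ 0 → ∀ B, f B ≠ 0) :
    HasLaw (fun ω => receiveBeamformer (f (B ω)) (h ω)) (normalizedComplexGaussian N) μ := by
  have hr : Measurable fun ω => receiveBeamformer (f (B ω)) (h ω) :=
    (hf.comp hB).receiveBeamformer hh
  refine ⟨hr.aemeasurable, ?_⟩
  -- For `N = 0` the space is a point, which carries only one probability measure.
  rcases eq_or_ne N 0 with rfl | hN
  · have := Measure.isProbabilityMeasure_map (μ := μ) hr.aemeasurable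
    ext s -
    induction s using Subsingleton.set_cases <;> simp
  have hu : Measurable fun ω => unitVec (h ω) := measurable_unitVec.comp hh
  have hjoint := (indepFun_iff_map_prod_eq_prod_map_map hB.aemeasurable hu.aemeasurable).mp
    (hind.comp measurable_id measurable_unitVec)
  have hm : Measurable fun p : Matrix (Fin N) J ℂ × EuclideanSpace ℂ (Fin N) =>
      receiveBeamformer (f p.1) p.2 :=
    (hf.comp measurable_fst).receiveBeamformer measurable_snd
  have hprod := Measure.map_prod_map (gaussianMatrix N v) (stdComplexGaussianVec N)
    measurable_id measurable_unitVec
  have h1 : μ.map (fun ω => receiveBeamformer (f (B ω)) (h ω)) =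
      (μ.map fun ω => (B ω, unitVec (h ω))).map (fun p => receiveBeamformer (f p.1) p.2) := by
    rw [Measure.map_map hm (hB.prodMk hu)]
    congr 1
    exact funext fun ω => (receiveBeamformer_unitVec _ _).symm
  rw [← map_receiveBeamformer_gaussian v hf hequiv (hne hN), h1]
  have h2 : (μ.map fun ω => (B ω, unitVec (h ω))) =
      ((gaussianMatrix N v).prod (stdComplexGaussianVec N)).map (Prod.map id unitVec) := by
    rw [← hprod, Measure.map_id, ← hlaw]
    refine hjoint.trans ?_
    congr 1
  rw [h2, Measure.map_map hm (measurable_id.prodMap measurable_unitVec)]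
  congr 1
  exact funext fun p => receiveBeamformer_unitVec _ _

/-! ### Zero-forcing and MMSE filters -/

theorem zeroForcing_equivariant {N : ℕ} {J : Type*} [Fintype J] [DecidableEq J]
    {U : Matrix (Fin N) (Fin N) ℂ} (hU : U ∈ Matrix.unitaryGroup (Fin N) ℂ)
    (B : Matrix (Fin N) J ℂ) :
    1 - (U * B) * ((U * B)ᴴ * (U * B))⁻¹ * (U * B)ᴴ =
      U * (1 - B * (Bᴴ * B)⁻¹ * Bᴴ) * Uᴴ := by
  have h1 : (U * B)ᴴ * (U * B) = Bᴴ * B := by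
    rw [Matrix.conjTranspose_mul, Matrix.mul_assoc, ← Matrix.mul_assoc Uᴴ,
      conjTranspose_mul_self_of_unitary hU, Matrix.one_mul]
  rw [h1, Matrix.mul_sub, Matrix.sub_mul, Matrix.mul_one, mul_conjTranspose_self_of_unitary hU,
    Matrix.conjTranspose_mul]
  simp only [Matrix.mul_assoc]

theorem zeroForcing_isHermitian {N : ℕ} {J : Type*} [Fintype J] [DecidableEq J]
    (B : Matrix (Fin N) J ℂ) : (1 - B * (Bᴴ * B)⁻¹ * Bᴴ).IsHermitian :=
  Matrix.isHermitian_one.sub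
    (Matrix.isHermitian_mul_mul_conjTranspose B (Matrix.isHermitian_conjTranspose_mul_self B).inv)

/-- Otherwise the identity, of rank `N`, would factor through a space of dimension `card J < N`. -/
theorem zeroForcing_ne_zero {N : ℕ} {J : Type*} [Fintype J] [DecidableEq J]
    (hJ : Fintype.card J < N) (B : Matrix (Fin N) J ℂ) : 1 - B * (Bᴴ * B)⁻¹ * Bᴴ ≠ 0 := by
  intro h
  have h1 : (1 : Matrix (Fin N) (Fin N) ℂ) = B * ((Bᴴ * B)⁻¹ * Bᴴ) := by
    rw [← Matrix.mul_assoc]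
    exact sub_eq_zero.mp h
  have h2 := Matrix.rank_mul_le_left B ((Bᴴ * B)⁻¹ * Bᴴ)
  rw [← h1, Matrix.rank_one, Fintype.card_fin] at h2
  exact absurd (h2.trans (Matrix.rank_le_card_width B)) (by omega)

open scoped ComplexOrder in
theorem isUnit_mul_conjTranspose_add_smul_one {N : ℕ} {J : Type*} [Fintype J] {c : ℝ} (hc : 0 < c)
    (B : Matrix (Fin N) J ℂ) : IsUnit (B * Bᴴ + (c : ℂ) • (1 : Matrix (Fin N) (Fin N) ℂ)) :=
  (Matrix.PosDef.posSemidef_add (Matrix.posSemidef_self_mul_conjTranspose B)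
    (Matrix.PosDef.one.smul (by exact_mod_cast hc))).isUnit

theorem mmse_equivariant {N : ℕ} {J : Type*} [Fintype J]
    {U : Matrix (Fin N) (Fin N) ℂ} (hU : U ∈ Matrix.unitaryGroup (Fin N) ℂ) (c : ℂ)
    (B : Matrix (Fin N) J ℂ) :
    ((U * B) * (U * B)ᴴ + c • (1 : Matrix (Fin N) (Fin N) ℂ))⁻¹ =
      U * (B * Bᴴ + c • (1 : Matrix (Fin N) (Fin N) ℂ))⁻¹ * Uᴴ := by
  have h1 : (U * B) * (U * B)ᴴ + c • (1 : Matrix (Fin N) (Fin N) ℂ) =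
      U * (B * Bᴴ + c • (1 : Matrix (Fin N) (Fin N) ℂ)) * Uᴴ := by
    rw [Matrix.mul_add, Matrix.add_mul, Matrix.mul_smul, Matrix.smul_mul, Matrix.mul_one,
      mul_conjTranspose_self_of_unitary hU, Matrix.conjTranspose_mul]
    simp only [Matrix.mul_assoc]
  rw [h1, Matrix.mul_inv_rev, Matrix.mul_inv_rev,
    Matrix.inv_eq_right_inv (conjTranspose_mul_self_of_unitary hU),
    Matrix.inv_eq_right_inv (mul_conjTranspose_self_of_unitary hU), Matrix.mul_assoc]

theorem mmse_isHermitian {N : ℕ} {J : Type*} [Fintype J] (c : ℝ) (B : Matrix (Fin N) J ℂ) :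
    (B * Bᴴ + (c : ℂ) • (1 : Matrix (Fin N) (Fin N) ℂ))⁻¹.IsHermitian := by
  refine Matrix.IsHermitian.inv ((Matrix.isHermitian_mul_conjTranspose_self B).add ?_)
  simp [Matrix.IsHermitian, Matrix.conjTranspose_smul]

/-! ### The three receivers -/

theorem mainTheorem6
    {Ω : Type*} [MeasurableSpace Ω] (μ : Measure Ω) [IsProbabilityMeasure μ]
    {Ω' : Type*} [MeasurableSpace Ω'] (μ' : Measure Ω') [IsProbabilityMeasure μ']
    -- `K` primary links; the receiver of link `k` has `N` antennas, transmitter `j` has `M j`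
    {K N : ℕ} (M : Fin K → ℕ) (k : Fin K)
    -- path losses, transmit powers and noise level
    (a p : Fin K → ℝ) (ha : ∀ j, 0 < a j) (hp : ∀ j, 0 < p j) (N₀ : ℝ) (hN₀ : 0 < N₀)
    -- channel matrices to receiver `k`, transmit beamforming vectors, and the matrix `Ĥ`
    (H : (j : Fin K) → Ω → Matrix (Fin N) (Fin (M j)) ℂ) (hH : ∀ j, Measurable (H j))
    (t : (j : Fin K) → Ω → EuclideanSpace ℂ (Fin (M j))) (ht : ∀ j, Measurable (t j))
    (htp : ∀ j, ∀ᵐ ω ∂μ, ‖t j ω‖ ^ 2 = p j)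
    (Hhat : Ω → Matrix (Fin N) (Fin K) ℂ)
    (hHhat : ∀ ω, Hhat ω = effectiveChannel a (fun j => H j ω) (fun j => t j ω))
    -- the columns of `Ĥ` are independent
    (hcol : iIndepFun (fun (j : Fin K) (ω : Ω) => column (Hhat ω) j) μ)
    -- the `k`-th column is distributed as `s • x`, with `x` a normalized complex Gaussian vector
    -- and `s` a positive scaling factor
    (s : Ω' → ℝ) (hs : Measurable s) (hs_pos : ∀ᵐ ω ∂μ', 0 < s ω)
    (x : Ω' → EuclideanSpace ℂ (Fin N)) (hx : HasLaw x (normalizedComplexGaussian N) μ')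
    (hk : IdentDistrib (fun ω => column (Hhat ω) k) (fun ω => (s ω : ℂ) • x ω) μ μ')
    -- the entries of the other columns are independent, those of column `j` being `CN(0, aⱼ pⱼ)`
    (hentries : iIndepFun
      (fun (q : Fin N × {j : Fin K // j ≠ k}) (ω : Ω) => deleteColumn (Hhat ω) k q.1 q.2) μ)
    (hgauss : ∀ (i : Fin N) (j : {j : Fin K // j ≠ k}),
      HasLaw (fun ω => deleteColumn (Hhat ω) k i j) (complexGaussian (a j * p j).toNNReal) μ) :
    -- matched filter
    (IsUnitarilyInvariant μ (fun _ => weightMF N) ∧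
      HasLaw (fun ω => receiveBeamformer (weightMF N) (column (Hhat ω) k))
        (normalizedComplexGaussian N) μ) ∧
    -- zero forcing
    (K ≤ N + 1 →
      (∀ᵐ ω ∂μ, IsUnit ((deleteColumn (Hhat ω) k)ᴴ * deleteColumn (Hhat ω) k)) ∧
      IsUnitarilyInvariant μ (fun ω => weightZF (Hhat ω) k)) ∧
    (K ≤ N →
      HasLaw (fun ω => receiveBeamformer (weightZF (Hhat ω) k) (column (Hhat ω) k))
        (normalizedComplexGaussian N) μ) ∧
    -- MMSE
    (IsUnitarilyInvariant μ (fun ω => weightMMSE N₀ (Hhat ω) k) ∧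
      HasLaw (fun ω => receiveBeamformer (weightMMSE N₀ (Hhat ω) k) (column (Hhat ω) k))
        (normalizedComplexGaussian N) μ) := by
  have hHm : Measurable Hhat := by
    refine measurable_matrix_mk fun i j => ?_
    simp only [hHhat, effectiveChannel, Matrix.mulVec, dotProduct]
    refine measurable_const.mul (Finset.measurable_sum _ fun l _ =>
      ((hH j).matrix_entry i l).mul ?_)
    exact (measurable_pi_apply l).comp ((WithLp.measurable_ofLp 2 _).comp (ht j))
  set B : Ω → Matrix (Fin N) {j : Fin K // j ≠ k} ℂ := fun ω => deleteColumn (Hhat ω) k with hBdef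
  have hB : Measurable B := measurable_matrix_mk fun i j => hHm.matrix_entry i j.1
  have hcm (j : Fin K) : Measurable fun ω => column (Hhat ω) j :=
    (WithLp.measurable_toLp 2 _).comp (measurable_pi_iff.mpr fun i => hHm.matrix_entry i j)
  set v : {j : Fin K // j ≠ k} → ℝ≥0 := fun j => (a j * p j).toNNReal with hvdef
  have hv (j) : v j ≠ 0 := (Real.toNNReal_pos.mpr (mul_pos (ha _) (hp _))).ne'
  have hlaw : μ.map B = gaussianMatrix N v := by
    have h1 := (iIndepFun_iff_map_fun_eq_pi_map
      (fun q : Fin N × {j : Fin K // j ≠ k} =>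
        (hB.matrix_entry q.1 q.2).aemeasurable)).mp hentries
    have h2 : (fun q : Fin N × {j : Fin K // j ≠ k} =>
        μ.map (fun ω => deleteColumn (Hhat ω) k q.1 q.2)) = fun q => complexGaussian (v q.2) :=
      funext fun q => (hgauss q.1 q.2).map_eq
    rw [h2] at h1
    rw [gaussianMatrix, ← h1, Measure.map_map (measurable_matrix_of_prod N)
      (measurable_pi_iff.mpr fun q => hB.matrix_entry q.1 q.2)]
    rfl
  have hind : IndepFun B (fun ω => column (Hhat ω) k) μ := by
    -- Independent columns are grouped into `{k}` and its complement.
    have h1 := hcol.indepFun_finset (Finset.univ.erase k) {k} (by simp) hcm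
    have hφ : Measurable fun (g : ↥(Finset.univ.erase k : Finset (Fin K)) →
        EuclideanSpace ℂ (Fin N)) => (Matrix.of fun i (j : {j : Fin K // j ≠ k}) =>
          (g ⟨j.1, by simp [j.2]⟩).ofLp i : Matrix (Fin N) {j : Fin K // j ≠ k} ℂ) :=
      measurable_matrix_mk fun i j => (measurable_pi_apply i).comp
        ((WithLp.measurable_ofLp 2 _).comp (measurable_pi_apply _))
    have hψ : Measurable fun (g : ↥({k} : Finset (Fin K)) → EuclideanSpace ℂ (Fin N)) =>
        g ⟨k, by simp⟩ := measurable_pi_apply _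
    exact h1.comp hφ hψ
  have hdir : μ.map (fun ω => unitVec (column (Hhat ω) k)) = normalizedComplexGaussian N := by
    have h1 := (hk.comp measurable_unitVec).map_eq
    -- The positive factor `s` disappears on normalizing, whatever its dependence on `x`.
    have h2 : (unitVec ∘ fun ω => (s ω : ℂ) • x ω) =ᵐ[μ'] unitVec ∘ x := by
      filter_upwards [hs_pos] with ω hω
      exact unitVec_smul hω _
    rw [Measure.map_congr h2, ← AEMeasurable.map_map_of_aemeasurable
      measurable_unitVec.aemeasurable hx.aemeasurable, hx.map_eq,
      map_unitVec_normalizedComplexGaussian] at h1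
    exact h1
  have hcard : Fintype.card {j : Fin K // j ≠ k} = K - 1 := by simp
  -- Guards the truncated `K - 1`: `K ≤ N + 1` and `K ≤ N` then mean at most, respectively fewer
  -- than, `N` interferers.
  have hk0 : 0 < K := k.pos
  have hMF : Measurable fun _ : Matrix (Fin N) {j : Fin K // j ≠ k} ℂ => weightMF N :=
    measurable_const
  have hMFe : ∀ U ∈ Matrix.unitaryGroup (Fin N) ℂ,
      ∀ _ : Matrix (Fin N) {j : Fin K // j ≠ k} ℂ, weightMF N = U * weightMF N * Uᴴ :=
    fun U hU _ => by rw [weightMF, Matrix.mul_one, mul_conjTranspose_self_of_unitary hU]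
  have hZF : Measurable fun C : Matrix (Fin N) {j : Fin K // j ≠ k} ℂ =>
      1 - C * (Cᴴ * C)⁻¹ * Cᴴ := by
    have h1 : Measurable fun C : Matrix (Fin N) {j : Fin K // j ≠ k} ℂ => C * (Cᴴ * C)⁻¹ * Cᴴ :=
      (measurable_id.matrix_mul
        (measurable_id.matrix_conjTranspose.matrix_mul measurable_id).matrix_inv).matrix_mul
        measurable_id.matrix_conjTranspose
    exact measurable_matrix_mk fun i j => measurable_const.sub (h1.matrix_entry i j)
  have hMMSE : Measurable fun C : Matrix (Fin N) {j : Fin K // j ≠ k} ℂ =>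
      (C * Cᴴ + (N₀ : ℂ) • (1 : Matrix (Fin N) (Fin N) ℂ))⁻¹ := by
    have h1 : Measurable fun C : Matrix (Fin N) {j : Fin K // j ≠ k} ℂ => C * Cᴴ :=
      measurable_id.matrix_mul measurable_id.matrix_conjTranspose
    refine Measurable.matrix_inv ?_
    exact measurable_matrix_mk fun i j => (h1.matrix_entry i j).add measurable_const
  have hMFn : N ≠ 0 → ∀ _ : Matrix (Fin N) {j : Fin K // j ≠ k} ℂ, weightMF N ≠ 0 := fun hN _ => by
    have : NeZero N := ⟨hN⟩
    exact one_ne_zero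
  have hMMSEn : N ≠ 0 → ∀ C : Matrix (Fin N) {j : Fin K // j ≠ k} ℂ,
      (C * Cᴴ + (N₀ : ℂ) • (1 : Matrix (Fin N) (Fin N) ℂ))⁻¹ ≠ 0 := fun hN C => by
    have : NeZero N := ⟨hN⟩
    exact (Matrix.isUnit_nonsing_inv_iff.mpr (isUnit_mul_conjTranspose_add_smul_one hN₀ C)).ne_zero
  have invMF := isUnitarilyInvariant_of_equivariant μ v hB hlaw hMF
    (fun _ => Matrix.isHermitian_one) hMFe
  have lawMF := hasLaw_receiveBeamformer_of_equivariant μ v hB hlaw (hcm k) hind hdir hMF hMFe hMFn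
  have invZF := isUnitarilyInvariant_of_equivariant μ v hB hlaw hZF zeroForcing_isHermitian
    fun U hU C => zeroForcing_equivariant hU C
  have lawZF (hKN : K ≤ N) := hasLaw_receiveBeamformer_of_equivariant μ v hB hlaw (hcm k) hind
    hdir hZF (fun U hU C => zeroForcing_equivariant hU C) fun _ => zeroForcing_ne_zero (by omega)
  have invMMSE := isUnitarilyInvariant_of_equivariant μ v hB hlaw hMMSE (mmse_isHermitian N₀)
    fun U hU C => mmse_equivariant hU _ C
  have lawMMSE := hasLaw_receiveBeamformer_of_equivariant μ v hB hlaw (hcm k) hind hdir hMMSE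
    (fun U hU C => mmse_equivariant hU _ C) hMMSEn
  refine ⟨⟨invMF, lawMF⟩, fun hKN => ⟨?_, invZF⟩, lawZF, invMMSE, lawMMSE⟩
  have h1 := ae_isUnit_gram_gaussianMatrix hv (N := N) (by omega)
  rw [← hlaw] at h1
  exact ae_of_ae_map hB.aemeasurable h1
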